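/- **Theorem (Unconditional energy dissipation).** Let $\Omega\subset\mathbb{R}^d$ be a bounded open set, let $\varepsilon>0$, let $Q:\mathbb{R}\to\mathbb{R}$ be differentiable, let $M:\mathbb{R}\to\mathbb{R}$, and let $W=W_c-W_e$ with $W_c,W_e:\mathbb{R}\to\mathbb{R}$ differentiable and both convex. Put $$E_\varepsilon[\phi]=\int_\Omega\Big(\frac1\varepsilon W(\phi)+\frac\varepsilon2|\nabla\phi|^2\Big)\,dx,\qquad \widehat Q'(b,a)=\begin{cases}\dfrac{Q(b)-Q(a)}{b-a},& b\ne a,\\[4pt] Q'(a),& b=a.\end{cases}$$ Let $\delta t>0$ be arbitrary, and let $\phi^n,\phi^{n+1},\psi^{n+1}\in H^1(\Omega)$ be such that $W(\phi^n)$ and $W(\phi^{n+1})$ are integrable over $\Omega$, $M(\phi^n)\ge 0$ a.e. in $\Omega$, and one step of the convex-splitting scheme with no-flux boundary conditions holds: $$\frac{Q(\phi^{n+1})-Q(\phi^n)}{\delta t}=\nabla\cdot\big(M(\phi^n)\nabla\psi^{n+1}\big),\qquad \widehat Q'(\phi^{n+1},\phi^n)\,\psi^{n+1}=\frac1\varepsilon\big(W_c'(\phi^{n+1})-W_e'(\phi^n)\big)-\varepsilon\Delta\phi^{n+1}$$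 a.e. in $\Omega$, with $\mathbf n\cdot M(\phi^n)\nabla\psi^{n+1}=0$ and $\mathbf n\cdot\nabla\phi^{n+1}=0$ on $\partial\Omega$. Here, for $J\in L^2(\Omega)^d$ and $f\in L^2(\Omega)$, "$\nabla\cdot J=f$ in $\Omega$ and $\mathbf n\cdot J=0$ on $\partial\Omega$" is understood in the usual weak sense $\int_\Omega J\cdot\nabla v\,dx=-\int_\Omega f\,v\,dx$ for all $v\in H^1(\Omega)$; it is applied to $J=M(\phi^n)\nabla\psi^{n+1}$ and to $J=\nabla\phi^{n+1}$ with $f=\Delta\phi^{n+1}$. Then $M(\phi^n)|\nabla\psi^{n+1}|^2$ and $|\nabla(\phi^{n+1}-\phi^n)|^2$ are integrable over $\Omega$ and $$E_\varepsilon[\phi^{n+1}]-E_\varepsilon[\phi^n]\le-\delta t\int_\Omega M(\phi^n)|\nabla\psi^{n+1}|^2\,dx-\frac\varepsilon2\int_\Omega|\nabla(\phi^{n+1}-\phi^n)|^2\,dx .$$ In particular $E_\varepsilon[\phi^{n+1}]\le E_\varepsilon[\phi^n]$. -/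

import Mathlib

open MeasureTheory
open scoped ContDiff

noncomputable section

namespace CHIC

/-- `ℝᵈ` with the Euclidean norm. -/
abbrev Space (d : ℕ) : Type := EuclideanSpace ℝ (Fin d)

/-- `g` is a weak (distributional) gradient of `u` on `Ω`: both are locally integrable on `Ω` and
`∫_Ω u ∇η = - ∫_Ω η g` (an identity of vectors) for every test function `η ∈ C_c^∞(Ω)`. -/
def IsWeakGradient {d : ℕ} (Ω : Set (Space d)) (u : Space d → ℝ) (g : Space d → Space d) : Prop :=
  LocallyIntegrableOn u Ω volume ∧ LocallyIntegrableOn g Ω volume ∧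
    ∀ η : Space d → ℝ, ContDiff ℝ ∞ η → HasCompactSupport η → tsupport η ⊆ Ω →
      ∫ x in Ω, u x • gradient η x = -∫ x in Ω, η x • g x

/-- The Sobolev space `H¹(Ω)`. -/
def MemH1 {d : ℕ} (Ω : Set (Space d)) (u : Space d → ℝ) : Prop :=
  MemLp u 2 (volume.restrict Ω) ∧
    ∃ g : Space d → Space d, MemLp g 2 (volume.restrict Ω) ∧ IsWeakGradient Ω u g

open Classical in
/-- The weak gradient `∇u` on `Ω` (unique almost everywhere on an open `Ω`); zero if there is
none. -/
def weakGrad {d : ℕ} (Ω : Set (Space d)) (u : Space d → ℝ) : Space d → Space d :=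
  if h : ∃ g, IsWeakGradient Ω u g then h.choose else 0

/-- `∇ · J = f` in `Ω` together with the no-flux condition `n · J = 0` on `∂Ω`, for a square
integrable field `J` whose divergence `f` is square integrable. As usual for such fields, the
vanishing of the normal component on the boundary means that Green's formula has no boundary
term, for all test functions in `H¹(Ω)`. -/
def IsNoFluxDivergence {d : ℕ} (Ω : Set (Space d)) (J : Space d → Space d) (f : Space d → ℝ) :
    Prop :=
  MemLp J 2 (volume.restrict Ω) ∧ MemLp f 2 (volume.restrict Ω) ∧
    ∀ v : Space d → ℝ, MemH1 Ω v →
      ∫ x in Ω, inner ℝ (J x) (weakGrad Ω v x) = -∫ x in Ω, f x * v x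

/-- The difference quotient `Q̂'(b, a)` of `Q`, equal to `Q'(a)` if `b = a`. -/
def diffQuot (Q : ℝ → ℝ) (b a : ℝ) : ℝ :=
  open Classical in if b = a then deriv Q a else (Q b - Q a) / (b - a)

/-- The diffuse-interface energy `∫_Ω (W(φ)/ε + (ε/2) |∇φ|²)`. -/
def energy {d : ℕ} (Ω : Set (Space d)) (ε : ℝ) (W : ℝ → ℝ) (φ : Space d → ℝ) : ℝ :=
  ∫ x in Ω, (1 / ε * W (φ x) + ε / 2 * ‖weakGrad Ω φ x‖ ^ 2)

/-- `φ` has finite energy: it lies in `H¹(Ω)` and `W(φ)` is integrable. -/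
def HasFiniteEnergy {d : ℕ} (Ω : Set (Space d)) (W : ℝ → ℝ) (φ : Space d → ℝ) : Prop :=
  MemH1 Ω φ ∧ IntegrableOn (fun x => W (φ x)) Ω volume

/-- `(φ₁, ψ)` is obtained from `φ₀` by one time step of length `δt` of the convex-splitting scheme
with no-flux boundary conditions:
`(Q(φ₁) - Q(φ₀)) / δt = ∇ · (M(φ₀) ∇ψ)` and
`Q̂'(φ₁, φ₀) ψ = (W_c'(φ₁) - W_e'(φ₀)) / ε - ε Δφ₁` in `Ω`,
`n · M(φ₀) ∇ψ = 0` and `n · ∇φ₁ = 0` on `∂Ω`. -/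
structure IsSchemeStep {d : ℕ} (Ω : Set (Space d)) (ε δt : ℝ) (Q M Wc We : ℝ → ℝ)
    (φ₀ φ₁ ψ : Space d → ℝ) : Prop where
  memH1_old : MemH1 Ω φ₀
  memH1_new : MemH1 Ω φ₁
  memH1_pot : MemH1 Ω ψ
  conservation :
    IsNoFluxDivergence Ω (fun x => M (φ₀ x) • weakGrad Ω ψ x)
      (fun x => (Q (φ₁ x) - Q (φ₀ x)) / δt)
  potential : ∃ lapl : Space d → ℝ,
    IsNoFluxDivergence Ω (weakGrad Ω φ₁) lapl ∧
      ∀ᵐ x ∂(volume.restrict Ω),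
        diffQuot Q (φ₁ x) (φ₀ x) * ψ x =
          1 / ε * (deriv Wc (φ₁ x) - deriv We (φ₀ x)) - ε * lapl x

end CHIC

end

namespace CHIC

/-! Test the conservation law with `ψ` and Green's formula for `∇φ₁` with `φ₁ - φ₀`. Multiplying the
potential equation by `φ₁ - φ₀` turns its left side into exactly `(Q(φ₁) - Q(φ₀)) ψ`
(`diffQuot_mul_sub`), so it matches the conservation law and produces the dissipation. Convexity
bounds the increment of `W` (`sub_le_convexSplitting`), and polarization handles the gradients. No
step restricts `δt`. -/

/-- The tangent line inequality for a differentiable convex function. -/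
lemma deriv_mul_sub_le_sub {f : ℝ → ℝ} (hf : ConvexOn ℝ Set.univ f) (hd : Differentiable ℝ f)
    (a b : ℝ) : deriv f a * (b - a) ≤ f b - f a := by
  rcases lt_trichotomy a b with h | rfl | h
  · have := hf.deriv_le_slope (Set.mem_univ a) (Set.mem_univ b) h (hd a)
    rwa [slope_def_field, le_div_iff₀ (sub_pos.2 h)] at this
  · simp
  · have := hf.slope_le_deriv (Set.mem_univ b) (Set.mem_univ a) h (hd a)
    rw [slope_def_field, div_le_iff₀ (sub_pos.2 h)] at this
    linarith

/-- Convex splitting: the implicit-explicit derivative controls the increment. -/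
lemma sub_le_convexSplitting {Wc We : ℝ → ℝ} (hWc : Differentiable ℝ Wc)
    (hWe : Differentiable ℝ We) (hWc_convex : ConvexOn ℝ Set.univ Wc)
    (hWe_convex : ConvexOn ℝ Set.univ We) (a b : ℝ) :
    (Wc b - We b) - (Wc a - We a) ≤ (deriv Wc b - deriv We a) * (b - a) := by
  -- The convex part uses its tangent at the new value, the concave part at the old one.
  have h₁ := deriv_mul_sub_le_sub hWc_convex hWc b a
  have h₂ := deriv_mul_sub_le_sub hWe_convex hWe a b
  linarith

/-- A discrete chain rule; on the diagonal both sides vanish, whatever value is assigned there. -/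
lemma diffQuot_mul_sub (Q : ℝ → ℝ) (b a : ℝ) : diffQuot Q b a * (b - a) = Q b - Q a := by
  unfold diffQuot
  split_ifs with h
  · simp [h]
  · exact div_mul_cancel₀ _ (sub_ne_zero.2 h)

variable {d : ℕ} {Ω : Set (Space d)}

lemma integrable_inner_of_memLp {α E : Type*} [MeasurableSpace α] {μ : Measure α}
    [NormedAddCommGroup E] [InnerProductSpace ℝ E] {f g : α → E} (hf : MemLp f 2 μ)
    (hg : MemLp g 2 μ) : Integrable (fun x => inner ℝ (f x) (g x)) μ :=
  (MemLp.integrable_mul hf.norm hg.norm).mono (hf.1.inner hg.1)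
    (Filter.Eventually.of_forall fun x => by
      simpa using norm_inner_le_norm (𝕜 := ℝ) (f x) (g x))

lemma integrableOn_smul_of_tsupport_subset {E : Type*} [NormedAddCommGroup E] [NormedSpace ℝ E]
    {η : Space d → ℝ} {g : Space d → E} (hg : LocallyIntegrableOn g Ω volume)
    (hη : Continuous η) (hc : HasCompactSupport η) (hs : tsupport η ⊆ Ω) :
    IntegrableOn (fun x => η x • g x) Ω volume := by
  refine Integrable.integrableOn ?_
  refine (integrableOn_iff_integrable_of_support_subset (s := tsupport η)
    ((Function.support_smul_subset_left η g).trans (subset_tsupport η))).1 ?_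
  exact (hg.integrableOn_compact_subset hs hc).continuousOn_smul hη.continuousOn hc

lemma integrableOn_smul_gradient {u η : Space d → ℝ} (hu : LocallyIntegrableOn u Ω volume)
    (hη : ContDiff ℝ ∞ η) (hc : HasCompactSupport η) (hs : tsupport η ⊆ Ω) :
    IntegrableOn (fun x => u x • gradient η x) Ω volume := by
  have hcont : Continuous (gradient η) :=
    (InnerProductSpace.toDual ℝ (Space d)).symm.continuous.comp (hη.continuous_fderiv (by simp))
  refine Integrable.integrableOn ?_
  have hsupp : Function.support (gradient η) ⊆ tsupport η := fun x hx => by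
    refine support_fderiv_subset ℝ fun h => hx ?_
    simp [gradient, h]
  refine (integrableOn_iff_integrable_of_support_subset (s := tsupport η)
    ((Function.support_smul_subset_right u _).trans hsupp)).1 ?_
  exact (hu.integrableOn_compact_subset hs hc).smul_continuousOn hcont.continuousOn hc

/-- Weak gradients on an open set are unique almost everywhere. -/
lemma IsWeakGradient.ae_eq (hΩ : IsOpen Ω) {u : Space d → ℝ} {g h : Space d → Space d}
    (hg : IsWeakGradient Ω u g) (hh : IsWeakGradient Ω u h) :
    g =ᵐ[volume.restrict Ω] h := by
  have key := hΩ.ae_eq_zero_of_integral_contDiff_smul_eq_zero (μ := volume)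
    (hg.2.1.sub hh.2.1) (fun η hη hc hs => by
      -- The fundamental lemma integrates over the whole space; `η` vanishes off `Ω`, so nothing is
      -- added.
      have hzero : ∀ x, x ∉ Ω → η x • (g - h) x = 0 := fun x hx => by
        rw [image_eq_zero_of_notMem_tsupport fun hx' => hx (hs hx'), zero_smul]
      rw [← setIntegral_eq_integral_of_forall_compl_eq_zero hzero]
      simp only [Pi.sub_apply, smul_sub]
      rw [integral_sub (integrableOn_smul_of_tsupport_subset hg.2.1 hη.continuous hc hs)
        (integrableOn_smul_of_tsupport_subset hh.2.1 hη.continuous hc hs), sub_eq_zero,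
        ← neg_inj, ← hg.2.2 η hη hc hs, ← hh.2.2 η hη hc hs])
  rw [Filter.EventuallyEq, ae_restrict_iff' hΩ.measurableSet]
  filter_upwards [key] with x hx hxΩ using sub_eq_zero.1 (hx hxΩ)

lemma IsWeakGradient.sub {u v : Space d → ℝ} {g h : Space d → Space d}
    (hu : IsWeakGradient Ω u g) (hv : IsWeakGradient Ω v h) :
    IsWeakGradient Ω (fun x => u x - v x) (fun x => g x - h x) := by
  refine ⟨hu.1.sub hv.1, hu.2.1.sub hv.2.1, fun η hη hc hs => ?_⟩
  simp only [sub_smul, smul_sub]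
  rw [integral_sub (integrableOn_smul_gradient hu.1 hη hc hs)
      (integrableOn_smul_gradient hv.1 hη hc hs),
    integral_sub (integrableOn_smul_of_tsupport_subset hu.2.1 hη.continuous hc hs)
      (integrableOn_smul_of_tsupport_subset hv.2.1 hη.continuous hc hs),
    hu.2.2 η hη hc hs, hv.2.2 η hη hc hs]
  abel

lemma MemH1.isWeakGradient_weakGrad {u : Space d → ℝ} (hu : MemH1 Ω u) :
    IsWeakGradient Ω u (weakGrad Ω u) := by
  obtain ⟨-, g, -, hg⟩ := hu
  have h : ∃ g, IsWeakGradient Ω u g := ⟨g, hg⟩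
  rw [weakGrad, dif_pos h]
  exact h.choose_spec

/-- `weakGrad` is chosen among all weak gradients, so square integrability has to be carried over
from the `H¹` witness by uniqueness. -/
lemma MemH1.memLp_weakGrad (hΩ : IsOpen Ω) {u : Space d → ℝ} (hu : MemH1 Ω u) :
    MemLp (weakGrad Ω u) 2 (volume.restrict Ω) := by
  have h := hu.isWeakGradient_weakGrad
  obtain ⟨-, g, hgL, hg⟩ := hu
  exact hgL.ae_eq (hg.ae_eq hΩ h)

lemma MemH1.sub (hΩ : IsOpen Ω) {u v : Space d → ℝ} (hu : MemH1 Ω u) (hv : MemH1 Ω v) :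
    MemH1 Ω (fun x => u x - v x) :=
  ⟨hu.1.sub hv.1, _, (hu.memLp_weakGrad hΩ).sub (hv.memLp_weakGrad hΩ),
    hu.isWeakGradient_weakGrad.sub hv.isWeakGradient_weakGrad⟩

lemma MemH1.weakGrad_sub (hΩ : IsOpen Ω) {u v : Space d → ℝ} (hu : MemH1 Ω u)
    (hv : MemH1 Ω v) :
    ∀ᵐ x ∂(volume.restrict Ω),
      weakGrad Ω (fun y => u y - v y) x = weakGrad Ω u x - weakGrad Ω v x :=
  (hu.sub hΩ hv).isWeakGradient_weakGrad.ae_eq hΩ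
    (hu.isWeakGradient_weakGrad.sub hv.isWeakGradient_weakGrad)

lemma MemH1.integrable_norm_weakGrad_sq (hΩ : IsOpen Ω) {u : Space d → ℝ} (hu : MemH1 Ω u) :
    Integrable (fun x => ‖weakGrad Ω u x‖ ^ 2) (volume.restrict Ω) := by
  simpa only [real_inner_self_eq_norm_sq] using
    integrable_inner_of_memLp (hu.memLp_weakGrad hΩ) (hu.memLp_weakGrad hΩ)

lemma HasFiniteEnergy.integrable (hΩ : IsOpen Ω) {W : ℝ → ℝ} {φ : Space d → ℝ} (ε : ℝ)
    (hφ : HasFiniteEnergy Ω W φ) :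
    Integrable (fun x => 1 / ε * W (φ x) + ε / 2 * ‖weakGrad Ω φ x‖ ^ 2)
      (volume.restrict Ω) :=
  (Integrable.const_mul hφ.2 _).add ((hφ.1.integrable_norm_weakGrad_sq hΩ).const_mul _)

/-- The energy law of a scheme step, before the dissipation is seen to be nonnegative. -/
lemma IsSchemeStep.energy_sub_le (hΩ : IsOpen Ω) {ε δt : ℝ} (hε : 0 < ε) (hδt : 0 < δt)
    {Q M W Wc We : ℝ → ℝ} (hWc : Differentiable ℝ Wc) (hWe : Differentiable ℝ We)
    (hWc_convex : ConvexOn ℝ Set.univ Wc) (hWe_convex : ConvexOn ℝ Set.univ We)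
    (hW : ∀ s, W s = Wc s - We s) {φ₀ φ₁ ψ : Space d → ℝ}
    (hφ₀ : HasFiniteEnergy Ω W φ₀) (hφ₁ : HasFiniteEnergy Ω W φ₁)
    (hstep : IsSchemeStep Ω ε δt Q M Wc We φ₀ φ₁ ψ) :
    energy Ω ε W φ₁ - energy Ω ε W φ₀ ≤
      -δt * (∫ x in Ω, M (φ₀ x) * ‖weakGrad Ω ψ x‖ ^ 2)
        - ε / 2 * ∫ x in Ω, ‖weakGrad Ω (fun y => φ₁ y - φ₀ y) x‖ ^ 2 := by
  obtain ⟨lapl, hlapl, hpot⟩ := hstep.potential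
  have hθ : MemH1 Ω (fun y => φ₁ y - φ₀ y) := hφ₁.1.sub hΩ hφ₀.1
  have hflux := hstep.conservation.2.2 ψ hstep.memH1_pot
  have hdiff := hlapl.2.2 _ hθ
  simp only [real_inner_smul_left, real_inner_self_eq_norm_sq] at hflux
  have i₁ : Integrable (fun x => (Q (φ₁ x) - Q (φ₀ x)) / δt * ψ x) (volume.restrict Ω) :=
    MemLp.integrable_mul hstep.conservation.2.1 hstep.memH1_pot.1
  have i₂ : Integrable (fun x => lapl x * (φ₁ x - φ₀ x)) (volume.restrict Ω) :=
    MemLp.integrable_mul hlapl.2.1 hθ.1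
  have i₃ := integrable_inner_of_memLp (hφ₁.1.memLp_weakGrad hΩ) (hθ.memLp_weakGrad hΩ)
  have i₄ := hθ.integrable_norm_weakGrad_sq hΩ
  -- The terms are grouped so that, after integration, `hflux` evaluates the first, while `hdiff`
  -- cancels the Laplacian against the inner product.
  have hpointwise : ∀ᵐ x ∂(volume.restrict Ω),
      (1 / ε * W (φ₁ x) + ε / 2 * ‖weakGrad Ω φ₁ x‖ ^ 2)
        - (1 / ε * W (φ₀ x) + ε / 2 * ‖weakGrad Ω φ₀ x‖ ^ 2) ≤
      δt * ((Q (φ₁ x) - Q (φ₀ x)) / δt * ψ x) + ε * (lapl x * (φ₁ x - φ₀ x))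
        + (ε * inner ℝ (weakGrad Ω φ₁ x) (weakGrad Ω (fun y => φ₁ y - φ₀ y) x)
        - ε / 2 * ‖weakGrad Ω (fun y => φ₁ y - φ₀ y) x‖ ^ 2) := by
    filter_upwards [hpot, hφ₁.1.weakGrad_sub hΩ hφ₀.1] with x hx hgrad
    have hsplit := mul_le_mul_of_nonneg_left
      (sub_le_convexSplitting hWc hWe hWc_convex hWe_convex (φ₀ x) (φ₁ x))
      (one_div_pos.2 hε).le
    rw [← hW, ← hW] at hsplit
    have hQ := diffQuot_mul_sub Q (φ₁ x) (φ₀ x)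
    have hQψ : δt * ((Q (φ₁ x) - Q (φ₀ x)) / δt * ψ x) =
        diffQuot Q (φ₁ x) (φ₀ x) * ψ x * (φ₁ x - φ₀ x) := by
      rw [← hQ]
      field_simp
    -- With `a = ∇φ₁`, `b = ∇φ₀`: `a · (a - b) - |a - b|² / 2 = (|a|² - |b|²) / 2`.
    rw [hQψ, hx, hgrad, norm_sub_sq_real, inner_sub_right, real_inner_self_eq_norm_sq]
    linarith
  have j₁ : Integrable (fun x => δt * ((Q (φ₁ x) - Q (φ₀ x)) / δt * ψ x)
      + ε * (lapl x * (φ₁ x - φ₀ x))) (volume.restrict Ω) :=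
    (i₁.const_mul δt).add (i₂.const_mul ε)
  have j₂ : Integrable (fun x =>
      ε * inner ℝ (weakGrad Ω φ₁ x) (weakGrad Ω (fun y => φ₁ y - φ₀ y) x)
        - ε / 2 * ‖weakGrad Ω (fun y => φ₁ y - φ₀ y) x‖ ^ 2) (volume.restrict Ω) :=
    (i₃.const_mul ε).sub (i₄.const_mul (ε / 2))
  have hint := integral_mono_ae ((hφ₁.integrable hΩ ε).sub (hφ₀.integrable hΩ ε)) (j₁.add j₂)
    hpointwise
  simp only [Pi.add_apply, Pi.sub_apply] at hint
  rw [integral_sub (hφ₁.integrable hΩ ε) (hφ₀.integrable hΩ ε),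
    integral_add j₁ j₂,
    integral_add (i₁.const_mul δt) (i₂.const_mul ε),
    integral_sub (i₃.const_mul ε) (i₄.const_mul (ε / 2))] at hint
  simp only [integral_const_mul] at hint
  rw [hdiff] at hint
  rw [hflux]
  unfold energy
  linarith

end CHIC

theorem mainTheorem6 {d : ℕ} (Ω : Set (CHIC.Space d)) (hΩ : IsOpen Ω)
    (hΩb : Bornology.IsBounded Ω) (ε : ℝ) (hε : 0 < ε)
    (Q M W Wc We : ℝ → ℝ) (hQ : Differentiable ℝ Q)
    (hWc : Differentiable ℝ Wc) (hWe : Differentiable ℝ We)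
    (hWc_convex : ConvexOn ℝ Set.univ Wc) (hWe_convex : ConvexOn ℝ Set.univ We)
    (hW : ∀ s, W s = Wc s - We s)
    (δt : ℝ) (hδt : 0 < δt) (φ₀ φ₁ ψ : CHIC.Space d → ℝ)
    (hM : ∀ᵐ x ∂(volume.restrict Ω), 0 ≤ M (φ₀ x))
    (hφ₀ : CHIC.HasFiniteEnergy Ω W φ₀) (hφ₁ : CHIC.HasFiniteEnergy Ω W φ₁)
    (hstep : CHIC.IsSchemeStep Ω ε δt Q M Wc We φ₀ φ₁ ψ) :
    IntegrableOn (fun x => M (φ₀ x) * ‖CHIC.weakGrad Ω ψ x‖ ^ 2) Ω volume ∧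
    IntegrableOn (fun x => ‖CHIC.weakGrad Ω (fun y => φ₁ y - φ₀ y) x‖ ^ 2) Ω volume ∧
    CHIC.energy Ω ε W φ₁ - CHIC.energy Ω ε W φ₀ ≤
      -δt * (∫ x in Ω, M (φ₀ x) * ‖CHIC.weakGrad Ω ψ x‖ ^ 2)
        - ε / 2 * ∫ x in Ω, ‖CHIC.weakGrad Ω (fun y => φ₁ y - φ₀ y) x‖ ^ 2 ∧
    CHIC.energy Ω ε W φ₁ ≤ CHIC.energy Ω ε W φ₀ := by

  -- Pairing the `L²` flux with the `L²` gradient avoids any bound on `M`.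
  have hψ : Integrable (fun x => M (φ₀ x) * ‖CHIC.weakGrad Ω ψ x‖ ^ 2)
      (volume.restrict Ω) := by
    simpa only [real_inner_smul_left, real_inner_self_eq_norm_sq] using
      CHIC.integrable_inner_of_memLp hstep.conservation.1 (hstep.memH1_pot.memLp_weakGrad hΩ)
  have hlaw := hstep.energy_sub_le hΩ hε hδt hWc hWe hWc_convex hWe_convex hW hφ₀ hφ₁
  refine ⟨hψ, (hφ₁.1.sub hΩ hφ₀.1).integrable_norm_weakGrad_sq hΩ, hlaw, ?_⟩
  have h₁ : 0 ≤ δt * ∫ x in Ω, M (φ₀ x) * ‖CHIC.weakGrad Ω ψ x‖ ^ 2 :=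
    mul_nonneg hδt.le (integral_nonneg_of_ae (hM.mono fun x hx => mul_nonneg hx (sq_nonneg _)))
  have h₂ : 0 ≤ ε / 2 * ∫ x in Ω, ‖CHIC.weakGrad Ω (fun y => φ₁ y - φ₀ y) x‖ ^ 2 :=
    mul_nonneg (half_pos hε).le (integral_nonneg fun x => sq_nonneg _)
  linarith
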